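/- **Setting.** For $k>1$ let $\beta_c(k)=\sqrt{2\pi}/k$. Let $\mathbf G=\mathbf G(n,d/n)$ be the Erdős–Rényi random graph on $n\ge 1$ vertices in which each edge is present independently with probability $d/n$ (where $0<d\le n$). Given $\mathbf G$, let $(\mathbf J_e)_{e\in E(\mathbf G)}$ be independent standard Gaussian couplings (the Edwards–Anderson model on $\mathbf G$). At inverse temperature $\beta>0$ the influence of an edge $e$ is $$\Gamma_e=\frac{|1-\exp(\beta \mathbf J_e)|}{1+\exp(\beta \mathbf J_e)},$$ and the aggregate influence of a vertex $u$ is $A(u)=\sum_{w\sim u}\Gamma_{\{u,w\}}$. For $\varepsilon,d>0$ the $(d,\varepsilon)$-weight of a vertex $u$ is $M(u)=1-\frac{\varepsilon}{4}$ if $A(u)\le 1-\frac{\varepsilon}{2}$, and $M(u)=d\cdot A(u)$ otherwise; the $(d,\varepsilon)$-weight of a (self-avoiding) path $P=(w_0,\dots,w_k)$ is $M(P)=\prod_{i=0}^{k}M(w_i)$, and its length is $k$. A vertex $u$ is a $(d,\varepsilon)$-block vertex if $M(P)<1$ for every path $P$ of length at most $\log n$ that starts at $u$. For real $r\ge 0$,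 a path $P$ is $r$-locally simple if the set of all vertices that are reachable from a vertex of $P$ by a path of length at most $r$ induces a tree in the graph. **Theorem.** For every $\varepsilon>0$ there exists $d_0=d_0(\varepsilon)\ge 1$ such that for every real $d\ge d_0$, every $\beta$ with $0<\beta\le(1-\varepsilon)\beta_c(d)$ and every integer $n\ge d$ the following holds. With $\ell=r=\frac{\log n}{\sqrt d}$, $$\Pr\left[\text{every $r$-locally simple path of length at least $\ell$ in $\mathbf G$ contains a $(d,\varepsilon)$-block vertex}\right]\ \ge\ 1-n^{-d^{1/8}},$$ where the probability is over $\mathbf G$ and the couplings. -/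

import Mathlib

open scoped SimpleGraph unitInterval
open MeasureTheory ProbabilityTheory

namespace EASpinGlass

/-- The threshold `β_c(k) = √(2π) / k`. -/
noncomputable def betaC (k : ℝ) : ℝ := Real.sqrt (2 * Real.pi) / k

/-- The influence of an edge with coupling `x` at inverse temperature `β`. -/
noncomputable def edgeInfluence (β x : ℝ) : ℝ :=
  |1 - Real.exp (β * x)| / (1 + Real.exp (β * x))

section Weights

variable {V : Type*} [Fintype V]

open Classical in
/-- The aggregate influence of `u`: the sum of the influences of the edges of `G` at `u`.
Only the couplings `J e` with `e` an edge of `G` are used. -/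
noncomputable def aggregateInfluence (G : SimpleGraph V) (J : Sym2 V → ℝ) (β : ℝ) (u : V) : ℝ :=
  ∑ w ∈ G.neighborFinset u, edgeInfluence β (J s(u, w))

open Classical in
/-- The `(d, ε)` vertex weight. -/
noncomputable def vertexWeight (d ε : ℝ) (G : SimpleGraph V) (J : Sym2 V → ℝ) (β : ℝ) (u : V) :
    ℝ :=
  if aggregateInfluence G J β u ≤ 1 - ε / 2 then 1 - ε / 4
  else d * aggregateInfluence G J β u

/-- The `(d, ε)` path weight: the product of the weights of all vertices
`w₀, …, w_ℓ` of the path, end points included. -/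
noncomputable def pathWeight (d ε : ℝ) {G : SimpleGraph V} (J : Sym2 V → ℝ) (β : ℝ) {u v : V}
    (P : G.Walk u v) : ℝ :=
  (P.support.map (vertexWeight d ε G J β)).prod

/-- `u` is a `(d, ε)`-block vertex: every path of length at most `log n` that starts at `u`
(the path of length `0` included) has weight less than `1`, where `n` is the number of vertices. -/
def IsBlockVertex (d ε : ℝ) (G : SimpleGraph V) (J : Sym2 V → ℝ) (β : ℝ) (u : V) : Prop :=
  ∀ (v : V) (P : G.Walk u v), P.IsPath → (P.length : ℝ) ≤ Real.log (Fintype.card V) →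
    pathWeight d ε J β P < 1

end Weights

section LocallySimple

variable {V : Type*}

/-- `N_r(P)`: the vertices that can be reached from a vertex of `P` by a path of length
at most `r`. -/
def pathNeighborhood {G : SimpleGraph V} (r : ℝ) {u v : V} (P : G.Walk u v) : Set V :=
  {x | ∃ y ∈ P.support, ∃ Q : G.Walk y x, Q.IsPath ∧ (Q.length : ℝ) ≤ r}

/-- `P` is an `r`-locally simple path: it is a path and `N_r(P)` induces a tree in `G`. -/
def IsLocallySimplePath {G : SimpleGraph V} (r : ℝ) {u v : V} (P : G.Walk u v) : Prop :=
  P.IsPath ∧ (G.induce (pathNeighborhood r P)).IsTree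

end LocallySimple

/-- The event that every `r`-locally simple path of length at least `l` contains a
`(d, ε)`-block vertex. -/
def EveryPathHasBlockVertex {V : Type*} [Fintype V] (r l d ε : ℝ) (G : SimpleGraph V)
    (J : Sym2 V → ℝ) (β : ℝ) : Prop :=
  ∀ (u v : V) (P : G.Walk u v), IsLocallySimplePath r P → l ≤ (P.length : ℝ) →
    ∃ x ∈ P.support, IsBlockVertex d ε G J β x

/-- The joint law of the random graph `G(n, p)` and of independent standard Gaussian couplings,
independent of the graph. A coupling is drawn for every unordered pair; those at
pairs that are not edges of the graph play no role. -/
noncomputable def graphCouplingLaw (n : ℕ) (p : I) :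
    Measure (SimpleGraph (Fin n) × (Sym2 (Fin n) → ℝ)) :=
  (SimpleGraph.binomialRandom (Fin n) p).prod
    (Measure.pi fun _ : Sym2 (Fin n) => gaussianReal 0 1)

end EASpinGlass

/-! Suppose a long locally simple path P has no block vertex. Then every vertex of P starts a path
of weight at least 1. With A the aggregate influence, put f = λ · max(A − (1 − 3ε/4), 0), where λ is
of order (log d)/ε, and δ = ε/4. Then M ≤ exp(f − δ) (`vertexWeight_nonneg_and_le_exp`), so f − δ
has nonnegative sum along each of these witness paths.

A witness of length more than r is by itself a long path on which f averages at least δ. If there is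
none, all witnesses lie in the tree around P, so each follows P and then leaves it for good. Keeping
for each vertex of P only the best path hanging off it, a two-sided maximal inequality along P
yields a caterpillar on which f averages at least δ/2 (`exists_hanging_sum_ge`,
`exists_heavy_caterpillar`).

Such caterpillars are unlikely. Grouped by edges, sums of influences are sums over independent
pairs. Since |tanh y| ≤ |y| and E|J| = 2/√(2π), the bound β ≤ (1 − ε)β_c(d) keeps the exponential
moment of d·A at a small parameter γ below exp(γd(1 − 3ε/4)) per vertex. Markov's inequality then
gains exp(−κ) per vertex with κ of order d/log d (`measure_edges_subset_and_excess_ge_le`). The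
entropy costs only a factor of order d per edge: n choices of a vertex against an edge probability
d/n (`measure_exists_caterpillar_le`). Hence the failure probability is at most n·exp(−κℓ/4), and κ
exceeds d^(5/8) by enough. -/

namespace EASpinGlass

/-! ### Maximal inequalities for sums over lists -/

section Lists

variable {V : Type*}

/-- A contiguous block of a duplicate-free list that starts with `w` is a prefix of the suffix
that starts with `w`. -/
theorem isPrefix_of_isInfix_of_isSuffix {l t s : List V} {w : V} (hl : l.Nodup)
    (ht : w :: t <:+ l) (hs : w :: s <:+: l) : w :: s <+: w :: t := by
  obtain ⟨l₁, rfl⟩ := ht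
  obtain ⟨l₂, l₃, h⟩ := hs
  rw [← h, List.append_assoc, List.cons_append] at hl
  have h2 : w ∉ l₂ := fun h => (List.nodup_append.1 hl).2.2 w h w (by simp) rfl
  have h3 : w ∉ s ++ l₃ := (List.nodup_cons.1 (List.nodup_append.1 hl).2.1).1
  have h4 : l₂ ++ w :: (s ++ l₃) = l₁ ++ w :: t := by simpa using h
  rw [List.append_cons_inj_of_notMem h2 h3] at h4
  rw [← h4.2.2]
  simp

theorem sum_map_sub_const (f : V → ℝ) (δ : ℝ) (l : List V) :
    (l.map fun x => f x - δ).sum = (l.map f).sum - δ * l.length := by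
  induction l with
  | nil => simp
  | cons a u ih => simp [ih]; ring

/-- A one-sided maximal inequality: if from every point of `R` some block starts on which
`Φ - δ` has nonnegative sum, then the sum of `Φ` is at least `δ` times the number of points
of `R`. -/
theorem mul_countP_le_sum_of_forall_isSuffix (Φ : V → ℝ) (δ : ℝ) (hΦ : ∀ x, 0 ≤ Φ x)
    (R : V → Bool) (l : List V)
    (H : ∀ w t, w :: t <:+ l → R w → ∃ s, w :: s <+: w :: t ∧
      0 ≤ ((w :: s).map fun x => Φ x - δ).sum) (hδ : 0 ≤ δ) :
    δ * l.countP R ≤ (l.map Φ).sum := by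
  induction hn : l.length using Nat.strong_induction_on generalizing l with
  | _ n ih =>
    cases l with
    | nil => simp
    | cons w t =>
      -- A point of `R` is removed with its whole block, whose `Φ`-sum is at least `δ` times its
      -- length; any other point is dropped alone, at no loss since `Φ ≥ 0`.
      by_cases hw : R w
      · obtain ⟨s, ⟨r, hr⟩, hs⟩ := H w t List.suffix_rfl hw
        have hr' : t = s ++ r := by simpa using hr.symm
        have h1 := ih r.length (by rw [← hn, hr']; simp) r (fun w' t' h' => by
          refine H w' t' (h'.trans ?_)
          exact ⟨w :: s, hr⟩) rfl
        rw [← hr, List.countP_append, List.map_append, List.sum_append]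
        have h2 : ((w :: s).map fun x => Φ x - δ).sum
            = ((w :: s).map Φ).sum - δ * (w :: s).length := sum_map_sub_const Φ δ _
        have h3 : (((w :: s).countP R : ℕ) : ℝ) ≤ (w :: s).length := by
          exact_mod_cast List.countP_le_length
        push_cast
        nlinarith
      · have h1 := ih t.length (by rw [← hn]; simp) t (fun w' t' h' => by
          exact H w' t' (h'.trans (List.suffix_cons w t))) rfl
        rw [List.countP_cons_of_neg (by simpa using hw)]
        have := hΦ w
        simp
        linarith

/-- A two-sided maximal inequality. -/
theorem mul_length_le_two_mul_sum (Φ : V → ℝ) (δ : ℝ) (hΦ : ∀ x, 0 ≤ Φ x) (hδ : 0 ≤ δ)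
    (l : List V) (hl : l.Nodup)
    (H : ∀ w ∈ l, ∃ s, (w :: s <:+: l ∨ w :: s <:+: l.reverse) ∧
      0 ≤ ((w :: s).map fun x => Φ x - δ).sum) :
    δ * l.length ≤ 2 * (l.map Φ).sum := by
  classical
  let R : List V → V → Bool := fun l w =>
    decide (∃ s, w :: s <:+: l ∧ 0 ≤ ((w :: s).map fun x => Φ x - δ).sum)
  have key : ∀ l : List V, l.Nodup → δ * l.countP (R l) ≤ (l.map Φ).sum := by
    intro l hl
    refine mul_countP_le_sum_of_forall_isSuffix Φ δ hΦ (R l) l ?_ hδ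
    intro w t ht hw
    obtain ⟨s, hs, hs'⟩ := of_decide_eq_true hw
    exact ⟨s, isPrefix_of_isInfix_of_isSuffix hl ht hs, hs'⟩
  have h1 := key l hl
  have h2 := key l.reverse (List.nodup_reverse.2 hl)
  rw [List.map_reverse, List.sum_reverse, List.countP_reverse] at h2
  -- Each point is counted in at least one of the two directions; adding the two one-sided bounds
  -- gives the factor 2.
  have h3 : l.length ≤ l.countP (R l) + l.countP (R l.reverse) := by
    have : ∀ w ∈ l, (R l w || R l.reverse w) = true := by
      intro w hw
      obtain ⟨s, hs | hs, hs'⟩ := H w hw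
      · simp only [Bool.or_eq_true]; left; exact decide_eq_true ⟨s, hs, hs'⟩
      · simp only [Bool.or_eq_true]; right; exact decide_eq_true ⟨s, hs, hs'⟩
    clear h1 h2 H
    generalize R l = A at *
    generalize R l.reverse = B at *
    induction l with
    | nil => simp
    | cons a l ih =>
      have ha := this a (by simp)
      have := ih (List.nodup_cons.1 hl).2 (fun w hw => this w (by simp [hw]))
      simp only [List.countP_cons, List.length_cons]
      rcases Bool.or_eq_true _ _ ▸ ha with h | h <;> simp [h] <;> omega
  have h4 : (l.length : ℝ) ≤ l.countP (R l) + l.countP (R l.reverse) := by exact_mod_cast h3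
  nlinarith

end Lists

/-! ### Paths that hang off a path inside a tree -/

section Hanging

variable {V : Type*} (G : SimpleGraph V)

/-- `l` is the list of vertices of a path of `G` inside `T`. -/
def IsPathList (T : Set V) (l : List V) : Prop :=
  l.IsChain G.Adj ∧ l.Nodup ∧ ∀ x ∈ l, x ∈ T

/-- `h` is a path that hangs off the vertex `w` of `p`. -/
def IsHanging (T : Set V) (p : List V) (w : V) (h : List V) : Prop :=
  IsPathList G T (w :: h) ∧ ∀ x ∈ h, x ∉ p

variable {G} {T : Set V} {p : List V}

theorem IsPathList.reverse {l : List V} (h : IsPathList G T l) : IsPathList G T l.reverse := by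
  refine ⟨?_, List.nodup_reverse.2 h.2.1, by simpa using h.2.2⟩
  rw [List.isChain_reverse]
  exact h.1.imp fun _ _ h => h.symm

theorem IsPathList.infix {l s : List V} (h : IsPathList G T l) (hs : s <:+: l) :
    IsPathList G T s :=
  ⟨h.1.infix hs, hs.nodup h.2.1, fun x hx => h.2.2 x (hs.subset hx)⟩

/-- Two lists of vertices that form paths with the same ends agree, if `T` induces an acyclic
graph. -/
theorem IsPathList.eq_of_isAcyclic (hT : (G.induce T).IsAcyclic) {a b : V} {l l' : List V}
    (h : IsPathList G T (a :: l)) (h' : IsPathList G T (a :: l'))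
    (hb : (a :: l).getLast? = some b) (hb' : (a :: l').getLast? = some b) : l = l' := by
  have lift : ∀ l : List V, IsPathList G T l → ∃ m : List T, m.map Subtype.val = l ∧
      m.IsChain (G.induce T).Adj ∧ m.Nodup := by
    intro l hl
    obtain ⟨m, rfl⟩ : ∃ m : List T, m.map Subtype.val = l :=
      ⟨l.attachWith (· ∈ T) hl.2.2, by simp⟩
    refine ⟨m, rfl, ?_, hl.2.1.of_map _⟩
    have := hl.1
    rw [List.isChain_map] at this
    exact this
  obtain ⟨m, hm, hc, hn⟩ := lift _ h
  obtain ⟨m', hm', hc', hn'⟩ := lift _ h'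
  have hne : m ≠ [] := by rintro rfl; simp at hm
  have hne' : m' ≠ [] := by rintro rfl; simp at hm'
  let w := SimpleGraph.Walk.ofSupport m hne hc
  let w' := SimpleGraph.Walk.ofSupport m' hne' hc'
  have e1 : m.head hne = m'.head hne' := by
    apply Subtype.val_injective
    have h1 : (m.map Subtype.val).head (by rw [hm]; simp) = (m.head hne).val := List.head_map ..
    have h2 : (m'.map Subtype.val).head (by rw [hm']; simp) = (m'.head hne').val :=
      List.head_map ..
    rw [← h1, ← h2]
    simp [hm, hm']
  have e2 : m.getLast hne = m'.getLast hne' := by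
    apply Subtype.val_injective
    have h1 : (m.map Subtype.val).getLast (by rw [hm]; simp) = (m.getLast hne).val :=
      List.getLast_map ..
    have h2 : (m'.map Subtype.val).getLast (by rw [hm']; simp) = (m'.getLast hne').val :=
      List.getLast_map ..
    rw [← h1, ← h2]
    rw [List.getLast?_eq_some_getLast (by simp)] at hb hb'
    simp only [hm, hm']
    exact (Option.some_injective _ hb).trans (Option.some_injective _ hb').symm
  have hw : w.IsPath := by
    rw [SimpleGraph.Walk.isPath_def, SimpleGraph.Walk.support_ofSupport]; exact hn
  have hw' : (w'.copy e1.symm e2.symm).IsPath := by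
    rw [SimpleGraph.Walk.isPath_copy, SimpleGraph.Walk.isPath_def,
      SimpleGraph.Walk.support_ofSupport]
    exact hn'
  have := congrArg (fun q => q.1.support)
    ((hT.subsingleton_path _ _).elim ⟨w, hw⟩ ⟨_, hw'⟩)
  simp only [SimpleGraph.Walk.support_copy] at this
  rw [SimpleGraph.Walk.support_ofSupport, SimpleGraph.Walk.support_ofSupport] at this
  rw [this, hm'] at hm
  simpa using hm.symm

/-- Any two entries of a list are the ends of a block of the list or of its reverse. -/
theorem exists_isInfix_of_mem {w y : V} (hw : w ∈ p) (hy : y ∈ p) :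
    ∃ s, (w :: s <:+: p ∨ w :: s <:+: p.reverse) ∧ (w :: s).getLast? = some y := by
  obtain ⟨l, t, rfl⟩ := List.append_of_mem hw
  rcases List.mem_append.1 hy with h | h
  · obtain ⟨a, b, rfl⟩ := List.append_of_mem h
    refine ⟨b.reverse ++ [y], Or.inr ⟨t.reverse, a.reverse, by simp⟩, ?_⟩
    rw [← List.cons_append, List.getLast?_append]; simp
  · obtain ⟨a, b, hab⟩ := List.append_of_mem h
    cases a with
    | nil =>
      simp at hab
      exact ⟨[], Or.inl ⟨l, t, by simp⟩, by simp [hab.1]⟩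
    | cons c a =>
      simp at hab
      obtain ⟨rfl, rfl⟩ := hab
      refine ⟨a ++ [y], Or.inl ⟨l, b, by simp⟩, ?_⟩
      rw [← List.cons_append, List.getLast?_append]; simp

theorem IsPathList.block {w : V} {s : List V} (hp : IsPathList G T p)
    (hs : w :: s <:+: p ∨ w :: s <:+: p.reverse) : IsPathList G T (w :: s) :=
  hs.elim hp.infix hp.reverse.infix

/-- Paths hanging off different vertices of a path are disjoint. -/
theorem IsHanging.disjoint (hT : (G.induce T).IsAcyclic) (hp : IsPathList G T p) {w w' : V}
    (hw : w ∈ p) (hw' : w' ∈ p) (hne : w ≠ w') {h h' : List V} (hh : IsHanging G T p w h)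
    (hh' : IsHanging G T p w' h') : h.Disjoint h' := by
  intro x hx hx'
  obtain ⟨a, b, rfl⟩ := List.append_of_mem hx
  obtain ⟨a', b', rfl⟩ := List.append_of_mem hx'
  obtain ⟨s, hs, hl⟩ := exists_isInfix_of_mem hw hw'
  have hsp := hp.block hs
  have hmem : ∀ x ∈ w :: s, x ∈ p := fun x hx =>
    hs.elim (fun h => h.subset hx) (fun h => by simpa using h.subset hx)
  obtain ⟨s, rfl⟩ : ∃ s', s = s' ++ [w'] := by
    cases s using List.reverseRecOn with
    | nil => simp at hl; exact absurd hl hne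
    | append_singleton s c =>
      rw [← List.cons_append, List.getLast?_append] at hl
      simp at hl
      exact ⟨s, by rw [hl]⟩
  have h1 : IsPathList G T (w :: (a ++ [x])) := hh.1.infix ⟨[], b, by simp⟩
  have h2 : IsPathList G T (w' :: (a' ++ [x])) := hh'.1.infix ⟨[], b', by simp⟩
  -- A common vertex `x` is reached from `w` along `h`, and also along `p` to `w'` and then along
  -- `h'`. In a tree these paths agree, so `w'` would lie on `h`, which avoids `p`.
  have h3 : IsPathList G T (w :: (s ++ (w' :: (a' ++ [x])))) := by
    refine ⟨?_, ?_, ?_⟩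
    · have := List.isChain_split (R := G.Adj) (l₁ := w :: s) (c := w') (l₂ := a' ++ [x])
      simp only [List.cons_append] at this
      rw [this]
      exact ⟨hsp.1, h2.1⟩
    · have e : w :: (s ++ (w' :: (a' ++ [x]))) = (w :: (s ++ [w'])) ++ (a' ++ [x]) := by simp
      rw [e, List.nodup_append]
      refine ⟨hsp.2.1, (List.nodup_cons.1 h2.2.1).2, ?_⟩
      rintro y hy z hz rfl
      refine hh'.2 y ?_ (hmem y hy)
      simp at hz ⊢
      tauto
    · intro y hy
      simp only [List.mem_cons, List.mem_append] at hy
      rcases hy with rfl | hy | hy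
      · exact h1.2.2 _ (by simp)
      · exact hsp.2.2 y (by simp [hy])
      · exact h2.2.2 y (by simpa using hy)
  have h4 := IsPathList.eq_of_isAcyclic hT (b := x) h1 h3
    (by rw [← List.cons_append, List.getLast?_append]; simp)
    (by
      have e : w :: (s ++ (w' :: (a' ++ [x]))) = (w :: (s ++ (w' :: a'))) ++ [x] := by simp
      rw [e, List.getLast?_append]; simp)
  have h5 : w' ∈ a ++ [x] := by rw [h4]; simp
  refine hh.2 w' ?_ hw'
  simp at h5 ⊢
  tauto

/-- A path that starts on `p` follows `p` for a while and then hangs off `p`. -/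
theorem exists_block_append_hanging (hT : (G.induce T).IsAcyclic) (hp : IsPathList G T p) {w : V}
    (hw : w ∈ p) {q : List V} (hq : IsPathList G T (w :: q)) :
    ∃ s y h, w :: q = w :: s ++ h ∧ (w :: s <:+: p ∨ w :: s <:+: p.reverse) ∧
      (w :: s).getLast? = some y ∧ y ∈ p ∧ IsHanging G T p y h := by
  -- Cut at the last vertex `y` that lies on `p`; acyclicity then identifies the part up to `y` with
  -- a block of `p`.
  have split : ∀ (q : List V) (w : V), w ∈ p → ∃ c y h, w :: q = c ++ y :: h ∧ y ∈ p ∧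
      ∀ x ∈ h, x ∉ p := by
    intro q
    induction q with
    | nil => exact fun w hw => ⟨[], w, [], by simp, hw, by simp⟩
    | cons a q ih =>
      intro w hw
      by_cases ha : ∃ z ∈ a :: q, z ∈ p
      · by_cases ha' : a ∈ p
        · obtain ⟨c, y, h, h1, h2, h3⟩ := ih a ha'
          exact ⟨w :: c, y, h, by rw [h1]; simp, h2, h3⟩
        · obtain ⟨z, hz, hzp⟩ := ha
          have hz' : z ∈ q := by
            rcases List.mem_cons.1 hz with rfl | h
            · exact absurd hzp ha'
            · exact h
          obtain ⟨c, y, h, h1, h2, h3⟩ := ih z hzp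
          -- As `a` is off `p`, the induction hypothesis is applied to `w :: q` with `a` skipped;
          -- the cut is not at `w`, because `z` comes later and is on `p`.
          clear h1
          obtain ⟨c', y', h', h1', h2', h3'⟩ := ih w hw
          cases c' with
          | nil =>
            simp at h1'
            obtain ⟨rfl, rfl⟩ := h1'
            exact absurd hzp (h3' z hz')
          | cons e c' =>
            simp at h1'
            exact ⟨w :: a :: c', y', h', by simp [h1'.2], h2', h3'⟩
      · push Not at ha
        exact ⟨[], w, a :: q, by simp, hw, ha⟩
  obtain ⟨c, y, h, h1, h2, h3⟩ := split q w hw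
  obtain ⟨s, hs, hl⟩ := exists_isInfix_of_mem hw h2
  have e : ∃ s', c ++ [y] = w :: s' := by
    cases c with
    | nil => simp at h1; exact ⟨[], by simp [h1.1]⟩
    | cons d c => simp at h1; exact ⟨c ++ [y], by simp [h1.1]⟩
  obtain ⟨s', hs'⟩ := e
  have h4 : w :: q = w :: s' ++ h := by rw [← hs', h1]; simp
  have h5 : IsPathList G T (w :: s') := hq.infix ⟨[], h, by rw [h4]; simp⟩
  have h6 := h5.eq_of_isAcyclic hT (hp.block hs) (by rw [← hs', List.getLast?_append]; simp) hl
  subst h6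
  refine ⟨s', y, h, h4, hs, hl, h2, hq.infix ⟨c, [], by rw [h1]; simp⟩, h3⟩

/-- If every vertex of a path in an acyclic set starts a path on which `f - δ` has nonnegative
sum, then the path can be enlarged by disjoint hanging paths so that `f` is at least `δ / 2` on
average. -/
theorem exists_hanging_sum_ge [Finite V] (hT : (G.induce T).IsAcyclic) (hp : IsPathList G T p)
    (f : V → ℝ) (hf : ∀ x, 0 ≤ f x) {δ : ℝ} (hδ : 0 ≤ δ)
    (H : ∀ w ∈ p, ∃ q, IsPathList G T (w :: q) ∧ 0 ≤ ((w :: q).map fun x => f x - δ).sum) :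
    ∃ hang : V → List V, (∀ w ∈ p, (w :: hang w).IsChain G.Adj) ∧
      (p.flatMap fun w => w :: hang w).Nodup ∧
      δ / 2 * (p.flatMap fun w => w :: hang w).length ≤
        ((p.flatMap fun w => w :: hang w).map f).sum := by
  classical
  cases nonempty_fintype V
  let g : List V → ℝ := fun h => (h.map fun x => f x - δ).sum
  have hmax : ∀ w ∈ p, ∃ h, IsHanging G T p w h ∧ ∀ h', IsHanging G T p w h' → g h' ≤ g h := by
    intro w hw
    have hfin : {h : List V | IsHanging G T p w h}.Finite := by
      refine Set.Finite.subset (s := Set.range (Subtype.val : {l : List V // l.Nodup} → List V))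
        (Set.finite_range _) ?_
      intro h hh
      exact ⟨⟨h, (List.nodup_cons.1 hh.1.2.1).2⟩, rfl⟩
    have hne : {h : List V | IsHanging G T p w h}.Nonempty :=
      ⟨[], ⟨by simp, by simp, by simpa using hp.2.2 w hw⟩, by simp⟩
    obtain ⟨h, h1, h2⟩ := Set.exists_max_image _ g hfin hne
    exact ⟨h, h1, h2⟩
  choose! hang hh hg using hmax
  -- The empty hanging path competes, so the maximal gain is nonnegative.
  have hg0 : ∀ w ∈ p, 0 ≤ g (hang w) := by
    intro w hw
    have := hg w hw [] ⟨⟨by simp, by simp, by simpa using hp.2.2 w hw⟩, by simp⟩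
    simpa [g] using this
  refine ⟨hang, fun w hw => (hh w hw).1.1, ?_, ?_⟩
  · rw [List.nodup_flatMap]
    refine ⟨fun w hw => (hh w hw).1.2.1, ?_⟩
    have hpn : p.Pairwise (· ≠ ·) := hp.2.1
    refine hpn.imp_of_mem ?_
    intro w w' hw hw' hne x hx hx'
    rcases List.mem_cons.1 hx with rfl | hx
    · rcases List.mem_cons.1 hx' with rfl | hx'
      · exact hne rfl
      · exact (hh w' hw').2 x hx' hw
    · rcases List.mem_cons.1 hx' with rfl | hx'
      · exact (hh w hw).2 x hx hw'
      · exact IsHanging.disjoint hT hp hw hw' hne (hh w hw) (hh w' hw') hx hx'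
  -- Each vertex of `p` is credited with the gain of its best hanging path. A witness is thereby
  -- replaced by the block of `p` that it follows: credits before `y` only help, and the credit at
  -- `y` dominates the part that hangs off.
  · let Φ : V → ℝ := fun x => f x + if x ∈ p then g (hang x) else 0
    have hΦ : ∀ x, 0 ≤ Φ x := by
      intro x
      have := hf x
      by_cases hx : x ∈ p
      · have := hg0 x hx
        simp only [Φ, hx, if_true]; linarith
      · simp only [Φ, hx, if_false]; linarith
    have key := mul_length_le_two_mul_sum Φ δ hΦ hδ p hp.2.1 (by
      intro w hw
      obtain ⟨q, hq, hq'⟩ := H w hw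
      obtain ⟨s, y, h, h1, h2, h3, h4, h5⟩ := exists_block_append_hanging hT hp hw hq
      refine ⟨s, h2, ?_⟩
      rw [h1, List.map_append, List.sum_append] at hq'
      have h6 : (h.map fun x => f x - δ).sum ≤ g (hang y) := hg y h4 h h5
      obtain ⟨c, hc⟩ : ∃ c, w :: s = c ++ [y] := by
        rw [List.getLast?_eq_some_iff] at h3
        exact h3
      have hcp : ∀ x ∈ c ++ [y], x ∈ p := by
        intro x hx
        rw [← hc] at hx
        exact h2.elim (fun h => h.subset hx) (fun h => by simpa using h.subset hx)
      rw [hc] at hq' ⊢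
      rw [List.map_append, List.sum_append] at hq' ⊢
      have h7 : (c.map fun x => f x - δ).sum ≤ (c.map fun x => Φ x - δ).sum := by
        refine List.sum_le_sum ?_
        intro x hx
        have hxp := hcp x (by simp [hx])
        have := hg0 x hxp
        simp only [Φ, hxp, if_true]; linarith
      simp only [List.map_cons, List.map_nil, List.sum_cons, List.sum_nil, Φ, h4, if_true]
        at hq' h7 ⊢
      linarith)
    have e1 : (p.map Φ).sum = (p.map fun x => f x + g (hang x)).sum := by
      congr 1
      refine List.map_congr_left ?_
      intro x hx
      simp [Φ, hx]
    rw [e1] at key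
    -- The gain `g` already subtracts `δ` per hanging vertex, so charging `δ / 2` for each of them
    -- loses nothing.
    have e2 : ∀ l : List V, ((l.flatMap fun w => w :: hang w).map f).sum
        - δ / 2 * (l.flatMap fun w => w :: hang w).length ≥
        (l.map fun x => f x + g (hang x)).sum - δ / 2 * l.length := by
      intro l
      induction l with
      | nil => simp
      | cons a l ih =>
        have h8 : g (hang a) = ((hang a).map f).sum - δ * (hang a).length :=
          sum_map_sub_const f δ _
        have h9 : 0 ≤ δ * (hang a).length := by positivity
        simp only [List.flatMap_cons, List.map_cons, List.map_append, List.sum_cons,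
          List.sum_append, List.length_cons, List.length_append, List.cons_append]
        push_cast
        nlinarith
    have := e2 p
    linarith

end Hanging

/-! ### Caterpillars encoded by tagged lists -/

section Caterpillar

variable {V : Type*}

/-- The edges of a spine with paths hanging off it, encoded by the list of its vertices after the
first one. A vertex tagged `true` continues the spine, whose last vertex so far is `s`; a vertex
tagged `false` is attached to the preceding vertex `c` of the list. -/
def caterpillarEdges : V → V → List (V × Bool) → List (Sym2 V)
  | _, _, [] => []
  | s, _, (x, true) :: l => s(s, x) :: caterpillarEdges x x l
  | s, c, (x, false) :: l => s(c, x) :: caterpillarEdges s x l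

theorem length_caterpillarEdges (s c : V) (l : List (V × Bool)) :
    (caterpillarEdges s c l).length = l.length := by
  induction l generalizing s c with
  | nil => rfl
  | cons a l ih =>
    obtain ⟨x, b⟩ := a
    cases b <;> simp [caterpillarEdges, ih]

theorem exists_mem_of_mem_caterpillarEdges {s c : V} {l : List (V × Bool)} {e : Sym2 V}
    (he : e ∈ caterpillarEdges s c l) : ∃ x ∈ l.map Prod.fst, x ∈ e := by
  induction l generalizing s c with
  | nil => simp [caterpillarEdges] at he
  | cons a l ih =>
    obtain ⟨x, b⟩ := a
    cases b
    all_goals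
      rw [caterpillarEdges, List.mem_cons] at he
      rcases he with rfl | he
      · exact ⟨x, by simp, by simp⟩
      · obtain ⟨y, hy, hy'⟩ := ih he
        exact ⟨y, by simp only [List.map_cons, List.mem_cons]; exact Or.inr hy, hy'⟩

/-- Every edge brings in a new vertex, and neither end of the first edge occurs later in the list.
Distinctness is what gives one factor of the edge probability per listed vertex. -/
theorem nodup_caterpillarEdges {s c : V} {l : List (V × Bool)} (hs : s ∉ l.map Prod.fst)
    (hc : c ∉ l.map Prod.fst) (hl : (l.map Prod.fst).Nodup) : (caterpillarEdges s c l).Nodup := by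
  induction l generalizing s c with
  | nil => simp [caterpillarEdges]
  | cons a l ih =>
    obtain ⟨x, b⟩ := a
    rw [List.map_cons, List.nodup_cons] at hl
    rw [List.map_cons, List.mem_cons, not_or] at hs hc
    cases b
    · rw [caterpillarEdges, List.nodup_cons]
      refine ⟨fun h => ?_, ih hs.2 hl.1 hl.2⟩
      obtain ⟨y, hy, hy'⟩ := exists_mem_of_mem_caterpillarEdges h
      rcases Sym2.mem_iff.1 hy' with rfl | rfl
      · exact hc.2 hy
      · exact hl.1 hy
    · rw [caterpillarEdges, List.nodup_cons]
      refine ⟨fun h => ?_, ih hl.1 hl.1 hl.2⟩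
      obtain ⟨y, hy, hy'⟩ := exists_mem_of_mem_caterpillarEdges h
      rcases Sym2.mem_iff.1 hy' with rfl | rfl
      · exact hs.2 hy
      · exact hl.1 hy

/-- A path together with paths that hang off its vertices is a caterpillar. -/
theorem exists_caterpillar {G : SimpleGraph V} (hang : V → List V) {w : V} {t : List V}
    (hp : (w :: t).IsChain G.Adj) (hh : ∀ v ∈ w :: t, (v :: hang v).IsChain G.Adj) :
    ∃ l : List (V × Bool), w :: l.map Prod.fst = (w :: t).flatMap (fun v => v :: hang v) ∧
      ∀ e ∈ caterpillarEdges w w l, e ∈ G.edgeSet := by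
  -- The hypothesis on `l` is for all `c'` because `l` will be empty or start with a spine vertex,
  -- which ignores the attachment point.
  have attach : ∀ (h : List V) (s c : V) (l : List (V × Bool)), (c :: h).IsChain G.Adj →
      (∀ c', ∀ e ∈ caterpillarEdges s c' l, e ∈ G.edgeSet) →
      ∀ e ∈ caterpillarEdges s c (h.map (fun x => (x, false)) ++ l), e ∈ G.edgeSet := by
    intro h
    induction h with
    | nil => exact fun s c l _ hl => hl c
    | cons x h ih =>
      intro s c l hc hl e he
      rw [List.isChain_cons_cons] at hc
      rw [List.map_cons, List.cons_append, caterpillarEdges, List.mem_cons] at he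
      rcases he with rfl | he
      · exact hc.1
      · exact ih s x l hc.2 hl e he
  have spine : ∀ (t : List V) (s : V), (s :: t).IsChain G.Adj →
      (∀ v ∈ t, (v :: hang v).IsChain G.Adj) →
      ∃ l : List (V × Bool), l.map Prod.fst = t.flatMap (fun v => v :: hang v) ∧
        ∀ c, ∀ e ∈ caterpillarEdges s c l, e ∈ G.edgeSet := by
    intro t
    induction t with
    | nil => exact fun s _ _ => ⟨[], by simp, by simp [caterpillarEdges]⟩
    | cons x t ih =>
      intro s hc hh
      rw [List.isChain_cons_cons] at hc
      obtain ⟨l, h1, h2⟩ := ih x hc.2 (fun v hv => hh v (by simp [hv]))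
      refine ⟨(x, true) :: ((hang x).map (fun x => (x, false)) ++ l), ?_, ?_⟩
      · rw [List.flatMap_cons, ← h1]
        simp [Function.comp_def]
      · intro c e he
        rw [caterpillarEdges, List.mem_cons] at he
        rcases he with rfl | he
        · exact hc.1
        · exact attach (hang x) x x l (hh x (by simp)) h2 e he
  obtain ⟨l, h1, h2⟩ := spine t w hp (fun v hv => hh v (by simp [hv]))
  refine ⟨(hang w).map (fun x => (x, false)) ++ l, ?_, ?_⟩
  · rw [List.flatMap_cons, ← h1]
    simp [Function.comp_def]
  · exact attach (hang w) w w l (hh w (by simp)) h2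

end Caterpillar

/-! ### A missing block vertex forces a heavy caterpillar -/

section BlockVertices

variable {V : Type*}

theorem prod_le_exp_sum (M f : V → ℝ) (hM : ∀ u, 0 ≤ M u) (hMf : ∀ u, M u ≤ Real.exp (f u))
    (l : List V) : (l.map M).prod ≤ Real.exp (l.map f).sum := by
  induction l with
  | nil => simp
  | cons a l ih =>
    rw [List.map_cons, List.map_cons, List.prod_cons, List.sum_cons, Real.exp_add]
    refine mul_le_mul (hMf a) ih ?_ (Real.exp_pos _).le
    exact List.prod_nonneg (by simpa using fun x _ => hM x)

/-- If some long locally simple path has no block vertex, then the graph contains a large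
caterpillar on which `f` is large on average. -/
theorem exists_heavy_caterpillar [Fintype V] {d ε β r : ℝ} {G : SimpleGraph V} {J : Sym2 V → ℝ}
    (f : V → ℝ) (hf : ∀ u, 0 ≤ f u) {δ : ℝ} (hδ : 0 ≤ δ)
    (hM : ∀ u, 0 ≤ vertexWeight d ε G J β u)
    (hMf : ∀ u, vertexWeight d ε G J β u ≤ Real.exp (f u - δ))
    (h : ¬ EveryPathHasBlockVertex r r d ε G J β) :
    ∃ (v : V) (l : List (V × Bool)), r ≤ l.length ∧ (v :: l.map Prod.fst).Nodup ∧
      (∀ e ∈ caterpillarEdges v v l, e ∈ G.edgeSet) ∧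
      δ / 2 * (l.length + 1 : ℝ) ≤ ((v :: l.map Prod.fst).map f).sum := by
  unfold EveryPathHasBlockVertex at h
  push Not at h
  obtain ⟨u, v, P, hP, hr, hb⟩ := h
  have hb' : ∀ x ∈ P.support, ∃ (y : V) (Q : G.Walk x y), Q.IsPath ∧
      0 ≤ (Q.support.map fun z => f z - δ).sum := by
    intro x hx
    have := hb x hx
    unfold IsBlockVertex at this
    push Not at this
    obtain ⟨y, Q, hQ, -, hQ'⟩ := this
    refine ⟨y, Q, hQ, ?_⟩
    have := hQ'.trans (prod_le_exp_sum _ (fun z => f z - δ) hM hMf Q.support)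
    rwa [Real.one_le_exp_iff] at this
  have final : ∀ (w : V) (t : List V) (hang : V → List V), (w :: t).IsChain G.Adj →
      (∀ v ∈ w :: t, (v :: hang v).IsChain G.Adj) → r ≤ t.length →
      ((w :: t).flatMap fun v => v :: hang v).Nodup →
      δ / 2 * ((w :: t).flatMap fun v => v :: hang v).length ≤
        (((w :: t).flatMap fun v => v :: hang v).map f).sum →
      ∃ (v : V) (l : List (V × Bool)), r ≤ l.length ∧ (v :: l.map Prod.fst).Nodup ∧
      (∀ e ∈ caterpillarEdges v v l, e ∈ G.edgeSet) ∧
      δ / 2 * (l.length + 1 : ℝ) ≤ ((v :: l.map Prod.fst).map f).sum := by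
    intro w t hang h1 h2 h3 h4 h5
    obtain ⟨l, hl, he⟩ := exists_caterpillar hang h1 h2
    rw [← hl] at h4 h5
    have hlen : t.length ≤ l.length := by
      have e1 := congrArg List.length hl
      have e2 : ∀ t : List V, t.length ≤ (t.flatMap fun v => v :: hang v).length := by
        intro t
        induction t with
        | nil => simp
        | cons a t ih => simp only [List.flatMap_cons, List.length_append, List.length_cons]; omega
      have := e2 (w :: t)
      simp only [List.length_cons, List.length_map] at e1 this
      omega
    refine ⟨w, l, h3.trans (by exact_mod_cast hlen), h4, he, ?_⟩
    simpa using h5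
  -- A witness longer than `r` may leave the tree, but it is a caterpillar with nothing hanging and
  -- is long enough by itself.
  by_cases hlong : ∃ (x y : V) (Q : G.Walk x y), Q.IsPath ∧
      0 ≤ (Q.support.map fun z => f z - δ).sum ∧ r < Q.length
  · obtain ⟨x, y, Q, hQ, hs, hl⟩ := hlong
    have e : Q.support = x :: Q.support.tail := Q.cons_tail_support.symm
    refine final x Q.support.tail (fun _ => []) ?_ (by simp) ?_ ?_ ?_
    · rw [← e]; exact Q.isChain_adj_support
    · simpa using hl.le
    · rw [← e]; simpa using hQ.support_nodup
    · rw [← e]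
      rw [sum_map_sub_const] at hs
      have : 0 ≤ δ * Q.support.length := by positivity
      simp only [List.flatMap_singleton']
      linarith
  · push Not at hlong
    obtain ⟨hPp, hT⟩ := hP
    have e : P.support = u :: P.support.tail := P.cons_tail_support.symm
    have hsub : ∀ x ∈ P.support, ∀ (y : V) (Q : G.Walk x y), Q.IsPath → (Q.length : ℝ) ≤ r →
        IsPathList G (pathNeighborhood r P) Q.support := by
      intro x hx y Q hQ hl
      refine ⟨Q.isChain_adj_support, hQ.support_nodup, fun z hz => ?_⟩
      classical
      refine ⟨x, hx, Q.takeUntil z hz, hQ.takeUntil hz, le_trans ?_ hl⟩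
      exact_mod_cast Q.length_takeUntil_le_length hz
    have hr0 : 0 ≤ r := by
      obtain ⟨y, Q, hQ, hs⟩ := hb' u P.start_mem_support
      exact (Nat.cast_nonneg _).trans (hlong u y Q hQ hs)
    have hPl : IsPathList G (pathNeighborhood r P) P.support := by
      refine ⟨P.isChain_adj_support, hPp.support_nodup, fun z hz => ?_⟩
      exact ⟨z, hz, .nil, by simp, by simpa using hr0⟩
    obtain ⟨hang, h1, h2, h3⟩ := exists_hanging_sum_ge hT.isAcyclic hPl f hf hδ (by
      intro w hw
      obtain ⟨y, Q, hQ, hs⟩ := hb' w hw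
      refine ⟨Q.support.tail, ?_, ?_⟩
      · rw [Q.cons_tail_support]; exact hsub w hw y Q hQ (hlong w y Q hQ hs)
      · rw [Q.cons_tail_support]; exact hs)
    rw [e] at h1 h2 h3
    refine final u P.support.tail hang ?_ h1 ?_ h2 h3
    · rw [← e]; exact P.isChain_adj_support
    · simpa using hr

end BlockVertices

/-! ### Integrals of products over independent pairs -/

section Products

theorem lintegral_pi_prod {ι : Type*} [Fintype ι] {X : ι → Type*} [∀ i, MeasurableSpace (X i)]
    (μ : ∀ i, Measure (X i)) [∀ i, IsProbabilityMeasure (μ i)] (φ : ∀ i, X i → ENNReal)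
    (hφ : ∀ i, Measurable (φ i)) :
    ∫⁻ x, ∏ i, φ i (x i) ∂Measure.pi μ = ∏ i, ∫⁻ y, φ i y ∂μ i := by
  refine (lintegral_prod_eq_prod_lintegral_of_indepFun Finset.univ
    (fun i (x : ∀ i, X i) => φ i (x i))
    (iIndepFun_pi fun i => (hφ i).aemeasurable)
    (fun i => (hφ i).comp (measurable_pi_apply i))).trans ?_
  refine Finset.prod_congr rfl fun i _ => ?_
  exact (measurePreserving_eval μ i).lintegral_comp (hφ i)

/-- The graph is the image of independent coins on all unordered pairs, diagonal ones included. A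
successful coin on the diagonal yields no edge, hence the argument `¬ e.IsDiag`. -/
theorem lintegral_binomialRandom_prod {V : Type*} [Fintype V] [DecidableEq V] (p : I)
    (k : Sym2 V → Prop → ENNReal) :
    ∫⁻ G, ∏ e, k e (e ∈ G.edgeSet) ∂SimpleGraph.binomialRandom V p =
      ∏ e : Sym2 V, (ENNReal.ofReal p * k e (¬ e.IsDiag) + ENNReal.ofReal (1 - p) * k e False) := by
  have hk : ∀ e, Measurable (k e) := fun e => measurable_from_top
  have hm : Measurable fun G : SimpleGraph V => ∏ e, k e (e ∈ G.edgeSet) := by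
    refine Finset.measurable_prod _ fun e _ => (hk e).comp ?_
    exact (measurable_set_iff.1 SimpleGraph.measurable_edgeSet) e
  rw [SimpleGraph.binomialRandom_eq_map, lintegral_map hm SimpleGraph.measurable_fromEdgeSet,
    setBernoulli_eq_map, Measure.infinitePi_eq_pi]
  refine (lintegral_map (hm.comp SimpleGraph.measurable_fromEdgeSet)
      (by exact MeasurableEquiv.setOfPred.measurable)).trans ?_
  have e1 : ∀ x : Sym2 V → Prop, ∏ e, k e (e ∈ (SimpleGraph.fromEdgeSet {i | x i}).edgeSet) =
      ∏ e, (fun e P => k e (P ∧ ¬ e.IsDiag)) e (x e) := by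
    intro x
    refine Finset.prod_congr rfl fun e _ => ?_
    simp
  simp only [Function.comp_apply]
  simp_rw [e1]
  refine (lintegral_pi_prod _ (fun e P => k e (P ∧ ¬ e.IsDiag))
    (fun e => measurable_from_top)).trans ?_
  refine Finset.prod_congr rfl fun e _ => ?_
  rw [lintegral_add_measure, lintegral_smul_measure, lintegral_smul_measure]
  simp only [lintegral_dirac]
  simp only [Sym2.mem_diagSet, Set.mem_compl_iff, and_self, false_and]
  rw [ENNReal.ofReal_eq_coe_nnreal p.2.1, ENNReal.ofReal_eq_coe_nnreal (sub_nonneg.2 p.2.2)]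
  rfl

end Products

/-! ### Double counting of vertices and edges -/

section Incidence

variable {V : Type*}

open Classical in
/-- The number of ends of `e` in `S`. -/
noncomputable def endCount (S : Finset V) (e : Sym2 V) : ℕ := (S.filter (· ∈ e)).card

theorem endCount_le_two (S : Finset V) (e : Sym2 V) : endCount S e ≤ 2 := by
  classical
  induction e using Sym2.ind with
  | _ a b =>
    refine le_trans (Finset.card_le_card (t := {a, b}) ?_) Finset.card_le_two
    intro x hx
    simpa using (Finset.mem_filter.1 hx).2

theorem sum_endCount_le [Fintype V] (S : Finset V) :
    ∑ e : Sym2 V, endCount S e ≤ S.card * Fintype.card V := by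
  classical
  simp only [endCount, Finset.card_filter]
  rw [Finset.sum_comm]
  have : ∀ u ∈ S, ∑ e : Sym2 V, (if u ∈ e then 1 else 0) ≤ Fintype.card V := by
    intro u _
    rw [← Finset.card_filter]
    refine le_trans (Finset.card_le_card (t := Finset.univ.image fun w => s(u, w)) ?_)
      Finset.card_image_le
    intro e he
    obtain ⟨w, rfl⟩ := (Finset.mem_filter.1 he).2
    exact Finset.mem_image.2 ⟨w, Finset.mem_univ _, rfl⟩
  simpa using Finset.sum_le_sum this

-- Influences at different vertices share edges; regrouping by pairs restores independence, at the
-- price of a multiplicity of at most 2.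
open Classical in
theorem sum_aggregateInfluence [Fintype V] (G : SimpleGraph V) (J : Sym2 V → ℝ) (β : ℝ)
    (S : Finset V) :
    ∑ u ∈ S, aggregateInfluence G J β u =
      ∑ e : Sym2 V, if e ∈ G.edgeSet then endCount S e * edgeInfluence β (J e) else 0 := by
  have h : ∀ u, aggregateInfluence G J β u =
      ∑ e : Sym2 V, if e ∈ G.edgeSet then (if u ∈ e then edgeInfluence β (J e) else 0) else 0 := by
    intro u
    simp_rw [← ite_and]
    rw [← Finset.sum_filter]
    refine Finset.sum_nbij (fun w => s(u, w)) ?_ ?_ ?_ ?_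
    · intro w hw
      simpa using hw
    · intro w _ w' _ h
      exact Sym2.congr_right.1 h
    · intro e he
      obtain ⟨h1, w, rfl⟩ := (Finset.mem_filter.1 he).2
      exact ⟨w, by simpa using h1, rfl⟩
    · intro w _
      rfl
  simp_rw [h]
  rw [Finset.sum_comm]
  refine Finset.sum_congr rfl fun e _ => ?_
  by_cases he : e ∈ G.edgeSet
  · simp only [he, if_true]
    rw [← Finset.sum_filter, Finset.sum_const, nsmul_eq_mul, endCount]
  · simp [he]

end Incidence

/-! ### Exponential moments of aggregate influences -/

section Moments

theorem measurable_edgeInfluence (β : ℝ) : Measurable (edgeInfluence β) := by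
  unfold edgeInfluence
  fun_prop

open Classical in
/-- The contribution of the pair `e` to the exponential moment of the aggregate influences over
`S`, on the event that the pairs in `F` are edges. -/
noncomputable def edgeFactor {V : Type*} (F : Finset (Sym2 V)) (S : Finset V) (s β : ℝ)
    (e : Sym2 V) (P : Prop) (x : ℝ) : ENNReal :=
  if P then ENNReal.ofReal (Real.exp (s * (endCount S e * edgeInfluence β x)))
  else if e ∈ F then 0 else 1

variable {V : Type*} [Fintype V] (F : Finset (Sym2 V)) (S : Finset V) (s β : ℝ)

theorem prod_edgeFactor {G : SimpleGraph V} (hF : ∀ e ∈ F, e ∈ G.edgeSet) (J : Sym2 V → ℝ) :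
    ∏ e, edgeFactor F S s β e (e ∈ G.edgeSet) (J e) =
      ENNReal.ofReal (Real.exp (s * ∑ u ∈ S, aggregateInfluence G J β u)) := by
  classical
  rw [sum_aggregateInfluence, Finset.mul_sum, Real.exp_sum,
    ENNReal.ofReal_prod_of_nonneg fun _ _ => (Real.exp_pos _).le]
  refine Finset.prod_congr rfl fun e _ => ?_
  by_cases he : e ∈ G.edgeSet
  · simp [edgeFactor, he]
  · have : e ∉ F := fun h => he (hF e h)
    simp [edgeFactor, he, this]

theorem measurable_prod_edgeFactor :
    Measurable fun ω : SimpleGraph V × (Sym2 V → ℝ) =>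
      ∏ e, edgeFactor F S s β e (e ∈ ω.1.edgeSet) (ω.2 e) := by
  classical
  refine Finset.measurable_prod _ fun e _ => ?_
  unfold edgeFactor
  have h1 : MeasurableSet {ω : SimpleGraph V × (Sym2 V → ℝ) | e ∈ ω.1.edgeSet} := by
    apply measurableSet_setOfPred.2
    exact ((measurable_set_iff.1 SimpleGraph.measurable_edgeSet) e).comp measurable_fst
  refine Measurable.ite h1 ?_ measurable_const
  have : Measurable fun ω : SimpleGraph V × (Sym2 V → ℝ) => edgeInfluence β (ω.2 e) :=
    (measurable_edgeInfluence β).comp ((measurable_pi_apply e).comp measurable_snd)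
  exact (Real.measurable_exp.comp ((this.const_mul _).const_mul _)).ennreal_ofReal

/-- The integral factorises over pairs. A pair in `F` must be an edge and costs at most `p * (1 + 2
* B)`; any other pair gives at most 1 + pBc ≤ exp(pBc) with c its `endCount`, and these counts sum
to at most `S.card * Fintype.card V`. -/
theorem lintegral_prod_edgeFactor_le {B : ℝ} (hB : 0 ≤ B)
    (hmgf : ∀ c : ℕ, c ≤ 2 → ∫⁻ x, ENNReal.ofReal (Real.exp (s * (c * edgeInfluence β x)))
      ∂gaussianReal 0 1 ≤ ENNReal.ofReal (1 + B * c)) (p : I) :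
    ∫⁻ ω : SimpleGraph V × (Sym2 V → ℝ), ∏ e, edgeFactor F S s β e (e ∈ ω.1.edgeSet) (ω.2 e)
      ∂((SimpleGraph.binomialRandom V p).prod (Measure.pi fun _ => gaussianReal 0 1)) ≤
    ENNReal.ofReal ((p * (1 + 2 * B)) ^ F.card * Real.exp (p * B * (S.card * Fintype.card V))) := by
  classical
  have hp0 : (0 : ℝ) ≤ p := p.2.1
  have hp1 : (0 : ℝ) ≤ 1 - p := sub_nonneg.2 p.2.2
  rw [lintegral_prod _ (measurable_prod_edgeFactor F S s β).aemeasurable]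
  let k : Sym2 V → Prop → ENNReal := fun e P => ∫⁻ x, edgeFactor F S s β e P x ∂gaussianReal 0 1
  have e1 : ∀ G : SimpleGraph V, ∫⁻ J : Sym2 V → ℝ,
      ∏ e, edgeFactor F S s β e (e ∈ G.edgeSet) (J e) ∂(Measure.pi fun _ => gaussianReal 0 1) =
      ∏ e, k e (e ∈ G.edgeSet) := by
    intro G
    refine lintegral_pi_prod (fun _ => gaussianReal 0 1)
      (fun e x => edgeFactor F S s β e (e ∈ G.edgeSet) x) fun e => ?_
    unfold edgeFactor
    split_ifs
    · exact (Real.measurable_exp.comp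
        (((measurable_edgeInfluence β).const_mul _).const_mul _)).ennreal_ofReal
    · exact measurable_const
    · exact measurable_const
  simp_rw [e1]
  rw [lintegral_binomialRandom_prod]
  have hT : ∀ e, k e True ≤ ENNReal.ofReal (1 + B * endCount S e) := by
    intro e
    simpa [k, edgeFactor] using hmgf _ (endCount_le_two S e)
  have hFalse : ∀ e, k e False = if e ∈ F then 0 else 1 := by
    intro e
    by_cases he : e ∈ F <;> simp [k, edgeFactor, he]
  have hle : ∀ e : Sym2 V, ENNReal.ofReal p * k e (¬ e.IsDiag) + ENNReal.ofReal (1 - p) * k e False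
      ≤ ENNReal.ofReal ((if e ∈ F then p * (1 + 2 * B) else 1) *
          Real.exp (p * B * endCount S e)) := by
    intro e
    have hc : (endCount S e : ℝ) ≤ 2 := by exact_mod_cast endCount_le_two S e
    have hc0 : (0 : ℝ) ≤ endCount S e := Nat.cast_nonneg _
    have hexp : 1 + p * B * endCount S e ≤ Real.exp (p * B * endCount S e) := by
      have := Real.add_one_le_exp (p * B * endCount S e); linarith
    have hpBc : 0 ≤ p * B * endCount S e := by positivity
    have hexp1 : 1 ≤ Real.exp (p * B * endCount S e) := by linarith
    rw [hFalse e]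
    by_cases hd : e.IsDiag
    · simp only [hd, not_true_eq_false, hFalse e]
      by_cases he : e ∈ F
      · simp [he]
      · simp only [he, if_false, mul_one, one_mul]
        rw [← ENNReal.ofReal_add hp0 hp1]
        exact ENNReal.ofReal_le_ofReal (by linarith)
    · simp only [hd, not_false_eq_true]
      by_cases he : e ∈ F
      · simp only [he, if_true, mul_zero, add_zero]
        refine (mul_le_mul_right (hT e) _).trans ?_
        rw [← ENNReal.ofReal_mul hp0]
        refine ENNReal.ofReal_le_ofReal ?_
        have h1 : p * (1 + B * endCount S e) ≤ p * (1 + 2 * B) :=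
          mul_le_mul_of_nonneg_left (by nlinarith) hp0
        have h2 : 0 ≤ p * (1 + 2 * B) := by positivity
        nlinarith
      · simp only [he, if_false, mul_one, one_mul]
        refine (add_le_add_left (mul_le_mul_right (hT e) _) _).trans ?_
        rw [← ENNReal.ofReal_mul hp0, ← ENNReal.ofReal_add (by positivity) hp1]
        exact ENNReal.ofReal_le_ofReal (by linarith)
  refine (Finset.prod_le_prod' fun e _ => hle e).trans ?_
  have hnn : 0 ≤ p * (1 + 2 * B) := by positivity
  rw [← ENNReal.ofReal_prod_of_nonneg (fun e _ => by split_ifs <;> positivity)]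
  refine ENNReal.ofReal_le_ofReal ?_
  rw [Finset.prod_mul_distrib, ← Real.exp_sum, ← Finset.mul_sum]
  have e2 : ∏ e : Sym2 V, (if e ∈ F then p * (1 + 2 * B) else 1) = (p * (1 + 2 * B)) ^ F.card := by
    rw [← Finset.prod_filter, Finset.prod_const]
    congr 2
    ext e
    simp
  rw [e2]
  refine mul_le_mul_of_nonneg_left (Real.exp_le_exp.2 ?_) (by positivity)
  refine mul_le_mul_of_nonneg_left ?_ (by positivity)
  exact_mod_cast sum_endCount_le S

/-- An exponential Markov inequality for the excess of the aggregate influences over `S`, on the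
event that the pairs in `F` are edges. -/
theorem measure_edges_subset_and_excess_ge_le {B a t : ℝ} (hB : 0 ≤ B)
    (hmgf : ∀ c : ℕ, c ≤ 2 → ∫⁻ x, ENNReal.ofReal (Real.exp (s * (c * edgeInfluence β x)))
      ∂gaussianReal 0 1 ≤ ENNReal.ofReal (1 + B * c)) (p : I)
    (ha : p * B * Fintype.card V ≤ s * a) :
    ((SimpleGraph.binomialRandom V p).prod (Measure.pi fun _ : Sym2 V => gaussianReal 0 1))
      {ω | (∀ e ∈ F, e ∈ ω.1.edgeSet) ∧
        t ≤ ∑ u ∈ S, s * max (aggregateInfluence ω.1 ω.2 β u - a) 0} ≤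
    ENNReal.ofReal ((p * (1 + 2 * B)) ^ F.card * 2 ^ S.card * Real.exp (-t)) := by
  classical
  have hp0 : (0 : ℝ) ≤ p := p.2.1
  let g : SimpleGraph V × (Sym2 V → ℝ) → ENNReal := fun ω => ∑ S' ∈ S.powerset,
    ENNReal.ofReal (Real.exp (-t - s * a * S'.card)) *
      ∏ e, edgeFactor F S' s β e (e ∈ ω.1.edgeSet) (ω.2 e)
  have hgm : ∀ S' ∈ S.powerset, Measurable fun ω : SimpleGraph V × (Sym2 V → ℝ) =>
      ENNReal.ofReal (Real.exp (-t - s * a * S'.card)) *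
      ∏ e, edgeFactor F S' s β e (e ∈ ω.1.edgeSet) (ω.2 e) :=
    fun S' _ => (measurable_prod_edgeFactor F S' s β).const_mul _
  refine (meas_le_lintegral₀ (f := g) (Finset.measurable_fun_sum _ hgm).aemeasurable ?_).trans ?_
  · rintro ⟨G, J⟩ ⟨hF, ht⟩
    simp only at hF ht
    -- Bounding the exponential of a positive part by 1 + exp and expanding the product gives a sum
    -- over subsets `S'`, without positive parts.
    have h1 : ∀ u ∈ S, Real.exp (s * max (aggregateInfluence G J β u - a) 0) ≤
        1 + Real.exp (s * (aggregateInfluence G J β u - a)) := by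
      intro u _
      rcases le_total (aggregateInfluence G J β u - a) 0 with h | h
      · rw [max_eq_right h]
        simp [Real.exp_nonneg]
      · rw [max_eq_left h]
        simp
    have h2 : Real.exp t ≤
        ∑ S' ∈ S.powerset, Real.exp (s * ∑ u ∈ S', (aggregateInfluence G J β u - a)) := by
      refine (Real.exp_le_exp.2 ht).trans ?_
      rw [Real.exp_sum]
      refine (Finset.prod_le_prod (fun _ _ => (Real.exp_pos _).le) h1).trans ?_
      rw [Finset.prod_one_add]
      refine Finset.sum_le_sum fun S' _ => ?_
      rw [Finset.mul_sum, Real.exp_sum]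
    have h3 : g (G, J) = ENNReal.ofReal (∑ S' ∈ S.powerset, Real.exp (-t) *
        Real.exp (s * ∑ u ∈ S', (aggregateInfluence G J β u - a))) := by
      rw [ENNReal.ofReal_sum_of_nonneg fun _ _ => by positivity]
      refine Finset.sum_congr rfl fun S' _ => ?_
      simp only
      rw [prod_edgeFactor F S' s β hF J, ← ENNReal.ofReal_mul (Real.exp_pos _).le, ← Real.exp_add,
        ← Real.exp_add]
      congr 2
      rw [Finset.sum_sub_distrib, Finset.sum_const, nsmul_eq_mul]
      ring
    rw [h3, ← ENNReal.ofReal_one]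
    refine ENNReal.ofReal_le_ofReal ?_
    rw [← Finset.mul_sum, Real.exp_neg, ← div_eq_inv_mul, le_div_iff₀ (Real.exp_pos t), one_mul]
    exact h2
  · rw [lintegral_finsetSum _ hgm]
    -- By `ha` the factor exp(−sa|S'|) cancels the moment growth, so all `2 ^ S.card` subsets obey
    -- the same bound.
    have h4 : ∀ S' ∈ S.powerset, ∫⁻ ω : SimpleGraph V × (Sym2 V → ℝ),
        ENNReal.ofReal (Real.exp (-t - s * a * S'.card)) *
          ∏ e, edgeFactor F S' s β e (e ∈ ω.1.edgeSet) (ω.2 e)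
        ∂((SimpleGraph.binomialRandom V p).prod (Measure.pi fun _ => gaussianReal 0 1)) ≤
        ENNReal.ofReal ((p * (1 + 2 * B)) ^ F.card * Real.exp (-t)) := by
      intro S' _
      rw [lintegral_const_mul _ (measurable_prod_edgeFactor F S' s β)]
      refine (mul_le_mul_right (lintegral_prod_edgeFactor_le F S' s β hB hmgf p) _).trans ?_
      rw [← ENNReal.ofReal_mul (Real.exp_pos _).le]
      refine ENNReal.ofReal_le_ofReal ?_
      rw [mul_left_comm, ← Real.exp_add]
      refine mul_le_mul_of_nonneg_left (Real.exp_le_exp.2 ?_) (by positivity)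
      have : (0 : ℝ) ≤ S'.card := Nat.cast_nonneg _
      nlinarith
    refine (Finset.sum_le_sum h4).trans ?_
    rw [Finset.sum_const, Finset.card_powerset, nsmul_eq_mul, ← ENNReal.ofReal_natCast,
      ← ENNReal.ofReal_mul (Nat.cast_nonneg _)]
    refine ENNReal.ofReal_le_ofReal (le_of_eq ?_)
    push_cast
    ring

end Moments

/-! ### The influence of a Gaussian coupling -/

section Gaussian

theorem integral_abs_gaussianReal :
    ∫ x, |x| ∂gaussianReal 0 1 = (Real.sqrt (2 * Real.pi))⁻¹ * 2 := by
  rw [integral_gaussianReal_eq_integral_smul one_ne_zero]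
  have e1 : ∀ x : ℝ, gaussianPDFReal 0 1 x • |x| =
      (fun y => (Real.sqrt (2 * Real.pi))⁻¹ * (y * Real.exp (-(1 / 2) * y ^ (2 : ℝ)))) |x| := by
    intro x
    simp only [gaussianPDFReal, smul_eq_mul, NNReal.coe_one, mul_one, sub_zero]
    rw [Real.rpow_two, sq_abs]
    ring_nf
  simp_rw [e1]
  refine (integral_comp_abs (f := fun y => (Real.sqrt (2 * Real.pi))⁻¹ *
    (y * Real.exp (-(1 / 2) * y ^ (2 : ℝ))))).trans ?_
  rw [integral_const_mul]
  have h := integral_rpow_mul_exp_neg_mul_rpow (p := 2) (q := 1) (b := 1 / 2) (by norm_num)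
    (by norm_num) (by norm_num)
  simp only [Real.rpow_one] at h
  rw [h]
  norm_num [Real.rpow_neg_one]
  ring

theorem exp_le_one_add_add_sq_mul_exp {y : ℝ} (hy : 0 ≤ y) :
    Real.exp y ≤ 1 + y + y ^ 2 * Real.exp y := by
  have h1 : Real.exp y ≤ 1 + y * Real.exp y := by
    have h := Real.add_one_le_exp (-y)
    have h2 : Real.exp y * Real.exp (-y) = 1 := by rw [← Real.exp_add]; simp
    nlinarith [Real.exp_pos y]
  nlinarith

/-- A bound for the exponential moments of the absolute value of a standard Gaussian. -/
theorem exists_lintegral_exp_abs_le : ∃ C : ℝ, 0 < C ∧ ∀ θ : ℝ, 0 ≤ θ → θ ≤ 1 →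
    ∫⁻ x, ENNReal.ofReal (Real.exp (θ * |x|)) ∂gaussianReal 0 1 ≤
      ENNReal.ofReal (1 + θ * ((Real.sqrt (2 * Real.pi))⁻¹ * 2) + θ ^ 2 * C) := by
  have i1 : Integrable (fun x : ℝ => |x|) (gaussianReal 0 1) :=
    ((memLp_id_gaussianReal 1).integrable (by simp)).abs
  have i2 : Integrable (fun x : ℝ => |x| ^ 2 * Real.exp |x|) (gaussianReal 0 1) := by
    have := integrable_pow_abs_mul_exp_add_of_integrable_exp_mul (X := fun x : ℝ => x)
      (μ := gaussianReal 0 1) (v := 0) (t := 2) (x := 1) (integrable_exp_mul_gaussianReal _)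
      (integrable_exp_mul_gaussianReal _) (by norm_num) (by norm_num) 2
    simpa using this
  refine ⟨∫ x, |x| ^ 2 * Real.exp |x| ∂gaussianReal 0 1 + 1, ?_, ?_⟩
  · have : 0 ≤ ∫ x, |x| ^ 2 * Real.exp |x| ∂gaussianReal 0 1 :=
      integral_nonneg fun x => by positivity
    linarith
  · intro θ h0 h1
    have i3 : Integrable (fun x : ℝ => 1 + θ * |x| + θ ^ 2 * (|x| ^ 2 * Real.exp |x|))
        (gaussianReal 0 1) :=
      ((integrable_const _).add (i1.const_mul _)).add (i2.const_mul _)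
    have h2 : ∀ x : ℝ, Real.exp (θ * |x|) ≤ 1 + θ * |x| + θ ^ 2 * (|x| ^ 2 * Real.exp |x|) := by
      intro x
      have h3 : 0 ≤ θ * |x| := by positivity
      have h4 : θ * |x| ≤ |x| := by nlinarith [abs_nonneg x]
      have h5 := exp_le_one_add_add_sq_mul_exp h3
      have h6 : (θ * |x|) ^ 2 * Real.exp (θ * |x|) ≤ (θ * |x|) ^ 2 * Real.exp |x| :=
        mul_le_mul_of_nonneg_left (Real.exp_le_exp.2 h4) (by positivity)
      nlinarith
    refine (lintegral_mono fun x => ENNReal.ofReal_le_ofReal (h2 x)).trans ?_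
    rw [← ofReal_integral_eq_lintegral_ofReal i3 (Filter.Eventually.of_forall fun x => by
      simp only [Pi.zero_apply]; positivity)]
    refine ENNReal.ofReal_le_ofReal ?_
    have i4 : Integrable (fun x : ℝ => 1 + θ * |x|) (gaussianReal 0 1) :=
      (integrable_const _).add (i1.const_mul _)
    rw [integral_add i4 (i2.const_mul _),
      integral_add (integrable_const _) (i1.const_mul _), integral_const_mul, integral_const_mul,
      integral_abs_gaussianReal]
    simp only [integral_const, probReal_univ, smul_eq_mul, mul_one]
    nlinarith [sq_nonneg θ]

/-- This is tanh(y/2) ≤ y/2 with denominators cleared; the derivative has the right sign because 1 −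
x ≤ exp(−x). -/
theorem exp_sub_one_le {y : ℝ} (hy : 0 ≤ y) : Real.exp y - 1 ≤ y / 2 * (1 + Real.exp y) := by
  have hd : ∀ x : ℝ, HasDerivAt (fun x => x / 2 * (1 + Real.exp x) - Real.exp x)
      (1 / 2 * (1 + Real.exp x) + x / 2 * Real.exp x - Real.exp x) x := by
    intro x
    exact (((hasDerivAt_id x).div_const 2).mul ((Real.hasDerivAt_exp x).const_add 1)).sub
      (Real.hasDerivAt_exp x)
  have hm : MonotoneOn (fun x => x / 2 * (1 + Real.exp x) - Real.exp x) (Set.Ici 0) := by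
    refine monotoneOn_of_deriv_nonneg (convex_Ici 0)
      (fun x _ => (hd x).continuousAt.continuousWithinAt)
      (fun x _ => (hd x).differentiableAt.differentiableWithinAt) ?_
    intro x hx
    rw [(hd x).deriv]
    have h := Real.add_one_le_exp (-x)
    have h2 : Real.exp x * Real.exp (-x) = 1 := by rw [← Real.exp_add]; simp
    nlinarith [Real.exp_pos x]
  have := hm (Set.mem_Ici.2 le_rfl) (Set.mem_Ici.2 hy) hy
  simp at this
  linarith

theorem edgeInfluence_le {β : ℝ} (hβ : 0 ≤ β) (x : ℝ) : edgeInfluence β x ≤ β * |x| / 2 := by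
  unfold edgeInfluence
  rw [div_le_iff₀ (by positivity)]
  rcases le_total 0 x with h | h
  · have hy : 0 ≤ β * x := mul_nonneg hβ h
    rw [abs_of_nonneg h, abs_of_nonpos (by have := Real.one_le_exp hy; linarith)]
    have := exp_sub_one_le hy
    linarith
  · have hy : 0 ≤ β * -x := mul_nonneg hβ (neg_nonneg.2 h)
    have h1 := exp_sub_one_le hy
    have h2 : Real.exp (β * x) * Real.exp (β * -x) = 1 := by rw [← Real.exp_add]; simp
    have h3 := Real.exp_pos (β * x)
    have h4 := Real.exp_pos (β * -x)
    have h5 : Real.exp (β * x) ≤ 1 := Real.exp_le_one_iff.2 (by linarith)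
    rw [abs_of_nonpos h, abs_of_nonneg (by linarith)]
    have h6 := mul_le_mul_of_nonneg_left h1 h3.le
    linear_combination h6 - (1 - β * -x / 2) * h2

/-- Here the threshold enters: (dβ/2)·E|J| ≤ 1 − ε is the first-order coefficient. The condition γ ≤
1/3 keeps the Gaussian parameter `θ` below 1, and c² ≤ 2c makes the quadratic error linear in `c`,
as needed for the double counting. -/
theorem exists_lintegral_exp_edgeInfluence_le : ∃ C : ℝ, 0 < C ∧ ∀ ε d β γ : ℝ, 0 < ε → 0 < d →
    0 < β → β ≤ (1 - ε) * betaC d → 0 < γ → γ ≤ 1 / 3 → ∀ c : ℕ, c ≤ 2 →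
    ∫⁻ x, ENNReal.ofReal (Real.exp (γ * d * (c * edgeInfluence β x))) ∂gaussianReal 0 1 ≤
      ENNReal.ofReal (1 + (γ * (1 - ε) + C * γ ^ 2) * c) := by
  obtain ⟨C, hC, H⟩ := exists_lintegral_exp_abs_le
  refine ⟨4 * C, by positivity, ?_⟩
  intro ε d β γ hε hd hβ hβ' hγ hγ' c hc
  have hc2 : (c : ℝ) ≤ 2 := by exact_mod_cast hc
  have hc0 : (0 : ℝ) ≤ c := Nat.cast_nonneg c
  have hq0 : 0 < Real.sqrt (2 * Real.pi) := Real.sqrt_pos.2 (by positivity)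
  have hq : Real.sqrt (2 * Real.pi) ≤ 2.6 := by
    rw [Real.sqrt_le_left (by norm_num)]
    have := Real.pi_lt_d2
    norm_num at this ⊢
    linarith
  set q := Real.sqrt (2 * Real.pi) with hqdef
  have hdβ : d * β ≤ (1 - ε) * q := by
    unfold betaC at hβ'
    rw [← hqdef, ← mul_div_assoc, le_div_iff₀ hd] at hβ'
    linarith
  have hdβ0 : 0 < d * β := mul_pos hd hβ
  set θ := γ * c * (d * β) / 2 with hθ
  have hθ0 : 0 ≤ θ := by positivity
  have hdβ3 : d * β ≤ 2.6 := by nlinarith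
  have hγd : γ * (d * β) ≤ 1 / 3 * 2.6 := mul_le_mul hγ' hdβ3 hdβ0.le (by norm_num)
  have hθ1 : θ ≤ 1 := by
    rw [hθ]
    nlinarith
  refine (lintegral_mono fun x => ENNReal.ofReal_le_ofReal (Real.exp_le_exp.2
    (?_ : _ ≤ θ * |x|))).trans ((H θ hθ0 hθ1).trans (ENNReal.ofReal_le_ofReal ?_))
  · have h1 := edgeInfluence_le hβ.le x
    have h2 : 0 ≤ γ * d * c := by positivity
    have := mul_le_mul_of_nonneg_left h1 h2
    rw [hθ]
    linarith
  · have h1 : θ * (q⁻¹ * 2) ≤ γ * (1 - ε) * c := by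
      have e : θ * (q⁻¹ * 2) = γ * c * (d * β / q) := by rw [hθ]; field_simp
      rw [e]
      have : d * β / q ≤ 1 - ε := by rw [div_le_iff₀ hq0]; exact hdβ
      have := mul_le_mul_of_nonneg_left this (by positivity : 0 ≤ γ * c)
      linarith
    have h2 : θ ^ 2 ≤ 4 * γ ^ 2 * c := by
      have e : θ ^ 2 = γ ^ 2 * c * (c * (d * β) ^ 2 / 4) := by rw [hθ]; ring
      rw [e]
      have h3 : (d * β) ^ 2 ≤ 2.6 ^ 2 := by gcongr
      have h4 : c * (d * β) ^ 2 / 4 ≤ 4 := by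
        norm_num at h3
        nlinarith [sq_nonneg (d * β)]
      have := mul_le_mul_of_nonneg_left h4 (by positivity : 0 ≤ γ ^ 2 * c)
      linarith
    have := mul_le_mul_of_nonneg_right h2 hC.le
    linarith

end Gaussian

/-! ### The union bound and the choice of constants -/

section UnionBound

/-- The excess of the aggregate influence bounds the logarithm of the vertex weight. -/
theorem vertexWeight_nonneg_and_le_exp {V : Type*} [Fintype V] {d ε β : ℝ} (hε : 0 < ε)
    (hε1 : ε < 1) (hd : 1 ≤ d) (G : SimpleGraph V) (J : Sym2 V → ℝ) (u : V) :
    0 ≤ vertexWeight d ε G J β u ∧ vertexWeight d ε G J β u ≤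
      Real.exp ((1 + 4 / ε * (Real.log d + 1)) *
        max (aggregateInfluence G J β u - (1 - 3 * ε / 4)) 0 - ε / 4) := by
  have hlog : 0 ≤ Real.log d := Real.log_nonneg hd
  unfold vertexWeight
  split_ifs with h
  · refine ⟨by linarith, ?_⟩
    have h1 := Real.add_one_le_exp ((1 + 4 / ε * (Real.log d + 1)) *
        max (aggregateInfluence G J β u - (1 - 3 * ε / 4)) 0 - ε / 4)
    have h2 : 0 ≤ (1 + 4 / ε * (Real.log d + 1)) *
        max (aggregateInfluence G J β u - (1 - 3 * ε / 4)) 0 := by positivity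
    linarith
  · push Not at h
    set A := aggregateInfluence G J β u
    have hA : 0 < A := by linarith
    refine ⟨by positivity, ?_⟩
    rw [max_eq_left (by linarith), ← Real.log_le_iff_le_exp (by positivity),
      Real.log_mul (by positivity) hA.ne']
    have h1 := Real.log_le_sub_one_of_pos hA
    -- Above 1 − ε/2 the excess is at least ε/4, so 4/ε times it pays for log d; the remaining
    -- single copy pays for log A ≤ A − 1.
    have h2 : Real.log d + 1 ≤ 4 / ε * (Real.log d + 1) * (A - (1 - 3 * ε / 4)) := by
      have h3 : 1 ≤ 4 / ε * (A - (1 - 3 * ε / 4)) := by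
        rw [div_mul_eq_mul_div, le_div_iff₀ hε]; linarith
      nlinarith
    linarith

theorem card_nodup_toFinset_of_caterpillar {V : Type*} [DecidableEq V] {v : V}
    {l : List (V × Bool)} (h : (v :: l.map Prod.fst).Nodup) :
    (caterpillarEdges v v l).toFinset.card = l.length ∧
      (v :: l.map Prod.fst).toFinset.card = l.length + 1 := by
  have h' := List.nodup_cons.1 h
  rw [List.toFinset_card_of_nodup (nodup_caterpillarEdges h'.1 h'.1 h'.2),
    List.toFinset_card_of_nodup h, length_caterpillarEdges]
  simp

/-- The union bound over all caterpillars. -/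
theorem measure_exists_caterpillar_le {n : ℕ} (p : I) (f : SimpleGraph (Fin n) →
      (Sym2 (Fin n) → ℝ) → Fin n → ℝ) {δ κ ℓ K d : ℝ} (hn : 1 ≤ n) (hp : (p : ℝ) = d / n)
    (hK : 0 ≤ K) (hd : 0 ≤ d)
    (hf : ∀ (F : Finset (Sym2 (Fin n))) (S : Finset (Fin n)), graphCouplingLaw n p
      {ω | (∀ e ∈ F, e ∈ ω.1.edgeSet) ∧ δ * S.card ≤ ∑ u ∈ S, f ω.1 ω.2 u} ≤
        ENNReal.ofReal ((p * K) ^ F.card * 2 ^ S.card * Real.exp (-(κ * S.card))))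
    (hκ : 4 ≤ κ) (hκd : 4 * K * d ≤ Real.exp (κ / 2)) :
    graphCouplingLaw n p {ω | ∃ (v : Fin n) (l : List (Fin n × Bool)), ℓ ≤ l.length ∧
      (v :: l.map Prod.fst).Nodup ∧ (∀ e ∈ caterpillarEdges v v l, e ∈ ω.1.edgeSet) ∧
      δ * (l.length + 1 : ℝ) ≤ ((v :: l.map Prod.fst).map (f ω.1 ω.2)).sum} ≤
    ENNReal.ofReal (n * Real.exp (-(κ / 4 * ℓ))) := by
  classical
  have hn0 : (0 : ℝ) < n := by exact_mod_cast hn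
  let I₀ : Finset ℕ := (Finset.range n).filter fun m => ℓ ≤ m
  let E : ∀ m : ℕ, Fin n × List.Vector (Fin n × Bool) m →
      Set (SimpleGraph (Fin n) × (Sym2 (Fin n) → ℝ)) := fun m c =>
    {ω | (c.1 :: c.2.1.map Prod.fst).Nodup ∧
      (∀ e ∈ caterpillarEdges c.1 c.1 c.2.1, e ∈ ω.1.edgeSet) ∧
      δ * (m + 1 : ℝ) ≤ ((c.1 :: c.2.1.map Prod.fst).map (f ω.1 ω.2)).sum}
  have hE : ∀ m c, graphCouplingLaw n p (E m c) ≤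
      ENNReal.ofReal ((p * K) ^ m * 2 ^ (m + 1) * Real.exp (-(κ * (m + 1)))) := by
    rintro m ⟨v, l, hl⟩
    by_cases hnd : (v :: l.map Prod.fst).Nodup
    · obtain ⟨h1, h2⟩ := card_nodup_toFinset_of_caterpillar hnd
      have := hf (caterpillarEdges v v l).toFinset (v :: l.map Prod.fst).toFinset
      rw [h1, h2, hl] at this
      push_cast at this
      refine le_trans (measure_mono ?_) this
      rintro ω ⟨-, h3, h4⟩
      refine ⟨fun e he => h3 e (List.mem_toFinset.1 he), ?_⟩
      rw [List.sum_toFinset _ hnd]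
      exact h4
    · have : E m ⟨v, l, hl⟩ = ∅ := by
        ext ω
        simp only [E, Set.mem_ofPred_eq, Set.mem_empty_iff_false, iff_false]
        exact fun h => hnd h.1
      rw [this]
      simp
  have hcover : {ω | ∃ (v : Fin n) (l : List (Fin n × Bool)), ℓ ≤ l.length ∧
      (v :: l.map Prod.fst).Nodup ∧ (∀ e ∈ caterpillarEdges v v l, e ∈ ω.1.edgeSet) ∧
      δ * (l.length + 1 : ℝ) ≤ ((v :: l.map Prod.fst).map (f ω.1 ω.2)).sum} ⊆
      ⋃ m ∈ I₀, ⋃ c ∈ (Finset.univ : Finset (Fin n × List.Vector (Fin n × Bool) m)), E m c := by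
    rintro ω ⟨v, l, h1, h2, h3, h4⟩
    have hlen : l.length < n := by
      have := h2.length_le_card
      simpa using this
    simp only [Set.mem_iUnion]
    exact ⟨l.length, by simp [I₀, hlen, h1], ⟨v, l, rfl⟩, Finset.mem_univ _, h2, h3, h4⟩
  have hterm : ∀ m ∈ I₀, graphCouplingLaw n p
      (⋃ c ∈ (Finset.univ : Finset (Fin n × List.Vector (Fin n × Bool) m)), E m c) ≤
      ENNReal.ofReal (n * Real.exp (-(κ / 4 * ℓ)) * (1 / 8) * (1 / 2) ^ m) := by
    intro m hm
    have hmℓ : ℓ ≤ m := (Finset.mem_filter.1 hm).2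
    refine (measure_biUnion_finset_le _ _).trans
      ((Finset.sum_le_sum fun c _ => hE m c).trans ?_)
    rw [Finset.sum_const, nsmul_eq_mul, ← ENNReal.ofReal_natCast,
      ← ENNReal.ofReal_mul (Nat.cast_nonneg _)]
    refine ENNReal.ofReal_le_ofReal ?_
    rw [Finset.card_univ, Fintype.card_prod, card_vector, Fintype.card_prod, Fintype.card_fin,
      Fintype.card_bool, hp]
    -- The powers of `n` cancel. Each edge costs `4 * K * d`: one factor 2 is the tag, the other
    -- comes from the subsets.
    have e1 : ((n * (n * 2) ^ m : ℕ) : ℝ) *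
        ((d / n * K) ^ m * 2 ^ (m + 1) * Real.exp (-(κ * (m + 1)))) =
        n * (2 * Real.exp (-κ)) * ((4 * K * d) ^ m * Real.exp (-(κ * m))) := by
      rw [show -(κ * (m + 1 : ℝ)) = -κ + -(κ * m) by ring, Real.exp_add]
      have : (d / n * K) = (4 * K * d) / (n * 2 * 2) := by field_simp; ring
      rw [this]
      push_cast
      rw [pow_succ, div_pow, mul_pow (n * 2 : ℝ) 2 m]
      field_simp
    rw [e1]
    have h1 : (4 * K * d) ^ m * Real.exp (-(κ * m)) ≤ Real.exp (-(κ / 2 * m)) := by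
      have : (4 * K * d) ^ m ≤ Real.exp (κ / 2 * m) := by
        rw [mul_comm (κ / 2), Real.exp_nat_mul]
        exact pow_le_pow_left₀ (by positivity) hκd m
      refine (mul_le_mul_of_nonneg_right this (Real.exp_pos _).le).trans (le_of_eq ?_)
      rw [← Real.exp_add]
      ring_nf
    have hhalf : Real.exp (-1) ≤ 1 / 2 := by
      rw [Real.exp_neg, one_div]
      exact inv_anti₀ (by norm_num) (by have := Real.add_one_le_exp 1; linarith)
    -- Half of `κ` has absorbed the entropy. One quarter gives the decay in `ℓ`, and the last, at
    -- least 1, a geometric series.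
    have h2 : Real.exp (-(κ / 2 * m)) ≤ Real.exp (-(κ / 4 * ℓ)) * (1 / 2) ^ m := by
      have h3 : Real.exp (-(κ / 2 * m)) ≤ Real.exp (-(κ / 4 * ℓ)) * Real.exp (m * (-1)) := by
        rw [← Real.exp_add]
        refine Real.exp_le_exp.2 ?_
        have : (0 : ℝ) ≤ m := Nat.cast_nonneg m
        nlinarith
      refine h3.trans (mul_le_mul_of_nonneg_left ?_ (Real.exp_pos _).le)
      rw [Real.exp_nat_mul]
      exact pow_le_pow_left₀ (Real.exp_pos _).le hhalf m
    have h4 : 2 * Real.exp (-κ) ≤ 1 / 8 := by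
      have h5 : Real.exp (-κ) ≤ Real.exp ((4 : ℕ) * (-1)) := by
        refine Real.exp_le_exp.2 ?_
        push_cast
        linarith
      rw [Real.exp_nat_mul] at h5
      have := pow_le_pow_left₀ (Real.exp_pos _).le hhalf 4
      norm_num at this h5 ⊢
      linarith
    calc n * (2 * Real.exp (-κ)) * ((4 * K * d) ^ m * Real.exp (-(κ * m)))
        ≤ n * (1 / 8) * (Real.exp (-(κ / 4 * ℓ)) * (1 / 2) ^ m) := by
          refine mul_le_mul (mul_le_mul_of_nonneg_left h4 hn0.le) (h1.trans h2) ?_ (by positivity)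
          positivity
      _ = n * Real.exp (-(κ / 4 * ℓ)) * (1 / 8) * (1 / 2) ^ m := by ring
  refine (measure_mono hcover).trans ((measure_biUnion_finset_le _ _).trans
    ((Finset.sum_le_sum hterm).trans ?_))
  rw [← ENNReal.ofReal_sum_of_nonneg fun _ _ => by positivity]
  refine ENNReal.ofReal_le_ofReal ?_
  rw [← Finset.mul_sum]
  have h5 : ∑ m ∈ I₀, (1 / 2 : ℝ) ^ m ≤ 2 := by
    refine (Finset.sum_le_sum_of_subset_of_nonneg (Finset.filter_subset _ _)
      fun _ _ _ => by positivity).trans ?_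
    exact sum_geometric_two_le n
  have h6 : 0 ≤ n * Real.exp (-(κ / 4 * ℓ)) := by positivity
  nlinarith

/-- The quotient is of order d/log d, whereas log d and d^(5/8) suffice. In terms of y = d^(1/8),
the denominator is at most y and the quotient at least 8y⁵. -/
theorem exists_threshold {c ε : ℝ} (hc : 0 < c) (hε : 0 < ε) : ∃ d₀ : ℝ, 1 ≤ d₀ ∧ ∀ d, d₀ ≤ d →
    12 * d ≤ Real.exp (c * d / (1 + 4 / ε * (Real.log d + 1)) / 2) ∧
    4 * (Real.sqrt d * (1 + d ^ (1 / 8 : ℝ))) ≤ c * d / (1 + 4 / ε * (Real.log d + 1)) := by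
  have ev1 : ∀ᶠ d : ℝ in Filter.atTop, Real.log d ≤ ε / 8 * d ^ (1 / 8 : ℝ) := by
    have := (isLittleO_log_rpow_atTop (show (0 : ℝ) < 1 / 8 by norm_num)).bound
      (show 0 < ε / 8 by positivity)
    filter_upwards [this, Filter.eventually_ge_atTop 1] with d h1 h2
    rw [Real.norm_of_nonneg (Real.log_nonneg h2),
      Real.norm_of_nonneg (Real.rpow_nonneg (by linarith) _)] at h1
    exact h1
  have ev2 : ∀ᶠ d : ℝ in Filter.atTop, 2 + 8 / ε + 8 / c ≤ d ^ (1 / 8 : ℝ) :=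
    (tendsto_rpow_atTop (by norm_num)).eventually_ge_atTop _
  obtain ⟨d₁, hd₁⟩ := Filter.eventually_atTop.1 (ev1.and ev2)
  refine ⟨max d₁ 12, le_trans (by norm_num) (le_max_right _ _), ?_⟩
  intro d hd
  obtain ⟨h1, h2⟩ := hd₁ d ((le_max_left _ _).trans hd)
  have h12 : 12 ≤ d := (le_max_right _ _).trans hd
  have hd0 : 0 ≤ d := by linarith
  set y := d ^ (1 / 8 : ℝ) with hy
  have hdy : d = y ^ 8 := by
    rw [hy, ← Real.rpow_natCast, ← Real.rpow_mul hd0]; norm_num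
  have hε8 : 0 < 8 / ε := by positivity
  have hc8 : 0 < 8 / c := by positivity
  have hy2 : 2 ≤ y := by linarith
  have hsq : Real.sqrt d = y ^ 4 := by
    rw [hdy, show y ^ 8 = (y ^ 4) ^ 2 by ring]
    exact Real.sqrt_sq (by positivity)
  have hlog : 0 ≤ Real.log d := Real.log_nonneg (by linarith)
  set lam := 1 + 4 / ε * (Real.log d + 1) with hlam
  have hlam0 : 0 < lam := by positivity
  have hlamy : lam ≤ y := by
    have h3 : 4 / ε * Real.log d ≤ y / 2 := by
      refine (mul_le_mul_of_nonneg_left h1 (by positivity)).trans (le_of_eq ?_)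
      field_simp
      norm_num
    have h4 : 4 / ε = 8 / ε / 2 := by ring
    have : lam = 1 + 4 / ε * Real.log d + 4 / ε := by rw [hlam]; ring
    linarith
  have hcy : 8 ≤ c * y := by
    have : 8 / c ≤ y := by linarith
    rw [div_le_iff₀ hc] at this
    linarith
  have hκ : 8 * y ^ 5 ≤ c * d / lam := by
    rw [le_div_iff₀ hlam0, hdy]
    calc 8 * y ^ 5 * lam ≤ (c * y) * y ^ 5 * y := by gcongr
      _ = c * y ^ 7 * 1 := by ring
      _ ≤ c * y ^ 7 * y := by gcongr; linarith
      _ = c * y ^ 8 := by ring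
  refine ⟨?_, ?_⟩
  · have h5 : (4 : ℕ) * Real.sqrt d ≤ c * d / lam / 2 := by
      rw [hsq]
      push_cast
      have : y ^ 4 * 1 ≤ y ^ 4 * y := by gcongr; linarith
      nlinarith
    refine le_trans ?_ (Real.exp_le_exp.2 h5)
    rw [Real.exp_nat_mul]
    have h6 : Real.sqrt d ≤ Real.exp (Real.sqrt d) := by
      have := Real.add_one_le_exp (Real.sqrt d); linarith
    calc 12 * d ≤ d ^ 2 := by nlinarith
      _ = (Real.sqrt d) ^ 4 := by
        rw [show (Real.sqrt d) ^ 4 = ((Real.sqrt d) ^ 2) ^ 2 by ring, Real.sq_sqrt hd0]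
      _ ≤ _ := pow_le_pow_left₀ (Real.sqrt_nonneg d) h6 4
  · refine le_trans ?_ hκ
    rw [hsq]
    have : y ^ 4 * (1 + y) ≤ y ^ 4 * (2 * y) := by gcongr; linarith
    nlinarith

end UnionBound

end EASpinGlass

/-! ### The theorem -/

open EASpinGlass in
theorem mainTheorem7 (ε : ℝ) (hε : 0 < ε) :
    ∃ d₀ : ℝ, 1 ≤ d₀ ∧ ∀ d : ℝ, d₀ ≤ d → ∀ β : ℝ, 0 < β → β ≤ (1 - ε) * EASpinGlass.betaC d →
      ∀ n : ℕ, 1 ≤ n → ∀ p : unitInterval, (p : ℝ) = d / n →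
        ∀ ℓ r : ℝ, ℓ = Real.log n / Real.sqrt d → r = ℓ →
          1 - (n : ℝ) ^ (-(d ^ (1 / 8 : ℝ))) ≤
            (EASpinGlass.graphCouplingLaw n p).real
              {ω | EASpinGlass.EveryPathHasBlockVertex r ℓ d ε ω.1 ω.2 β} := by
  -- For ε ≥ 1 no positive β is admissible.
  rcases le_or_gt 1 ε with hε1 | hε1
  · refine ⟨1, le_rfl, fun d hd β hβ hβ' => ?_⟩
    have h1 : 0 ≤ betaC d := by unfold betaC; positivity
    nlinarith
  obtain ⟨C, hC, hmgf⟩ := exists_lintegral_exp_edgeInfluence_le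
  -- The second bound makes Cγ² ≤ γε/4, so that `B ≤ γ * (1 - 3 * ε / 4)`.
  let γ : ℝ := min (1 / 3) (ε / (4 * C))
  have hγ : 0 < γ := lt_min (by norm_num) (by positivity)
  have hγ3 : γ ≤ 1 / 3 := min_le_left _ _
  have hγC : C * γ ≤ ε / 4 := by
    have : γ ≤ ε / (4 * C) := min_le_right _ _
    rw [le_div_iff₀ (by positivity)] at this
    linarith
  obtain ⟨d₀, hd₀, H⟩ := exists_threshold (c := γ * ε / 8) (by positivity) hε
  refine ⟨d₀, hd₀, ?_⟩
  rintro d hd β hβ hβ' n hn p hp ℓ r hℓ rfl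
  obtain ⟨H1, H2⟩ := H d hd
  have hd1 : 1 ≤ d := hd₀.trans hd
  have hd0 : 0 < d := by linarith
  have hn0 : (0 : ℝ) < n := by exact_mod_cast hn
  have hp0 : (0 : ℝ) ≤ p := p.2.1
  have hsqrt : 1 ≤ Real.sqrt d := Real.one_le_sqrt.2 hd1
  have hlogn : 0 ≤ Real.log n := Real.log_nonneg (by exact_mod_cast hn)
  have hlogd : 0 ≤ Real.log d := Real.log_nonneg hd1
  set lam := 1 + 4 / ε * (Real.log d + 1) with hlam
  have hlam0 : 0 < lam := by positivity
  set κ := γ * ε / 8 * d / lam with hκ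
  set B := γ * (1 - ε) + C * γ ^ 2 with hB
  have hB0 : 0 ≤ B := by
    have : 0 ≤ 1 - ε := by linarith
    positivity
  have hBa : B ≤ γ * (1 - 3 * ε / 4) := by rw [hB]; nlinarith
  have hB1 : B ≤ 1 := by nlinarith
  let f : SimpleGraph (Fin n) → (Sym2 (Fin n) → ℝ) → Fin n → ℝ := fun G J u =>
    lam * max (aggregateInfluence G J β u - (1 - 3 * ε / 4)) 0
  have hpr : IsProbabilityMeasure (graphCouplingLaw n p) := by
    unfold graphCouplingLaw; infer_instance
  have hy1 : 1 ≤ d ^ (1 / 8 : ℝ) := Real.one_le_rpow hd1 (by norm_num)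
  -- `δ` is half of ε/4, the average kept by the caterpillar; `K = 3` bounds 1 + 2B. Rescaling `f`
  -- by γd/λ turns this `δ` into `κ`.
  have hbad := measure_exists_caterpillar_le (δ := ε / 4 / 2) (κ := κ) (ℓ := r) (K := 3) (d := d)
    p f hn hp (by norm_num) hd0.le (by
      intro F S
      have key := measure_edges_subset_and_excess_ge_le F S (γ * d) β (B := B)
        (a := 1 - 3 * ε / 4) (t := κ * S.card) hB0 (hmgf ε d β γ hε hd0 hβ hβ' hγ hγ3) p (by
          rw [hp, Fintype.card_fin]
          have : d / n * B * n = d * B := by field_simp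
          rw [this]
          nlinarith)
      refine le_trans (measure_mono ?_) (key.trans (ENNReal.ofReal_le_ofReal ?_))
      · rintro ω ⟨h1, h2⟩
        refine ⟨h1, ?_⟩
        have e1 : ∑ u ∈ S, γ * d * max (aggregateInfluence ω.1 ω.2 β u - (1 - 3 * ε / 4)) 0 =
            γ * d / lam * ∑ u ∈ S, f ω.1 ω.2 u := by
          rw [Finset.mul_sum]
          refine Finset.sum_congr rfl fun u _ => ?_
          simp only [f]
          field_simp
        rw [e1]
        refine le_trans (le_of_eq ?_) (mul_le_mul_of_nonneg_left h2 (by positivity))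
        rw [hκ]
        ring
      · gcongr
        linarith)
    (by nlinarith) (by linarith)
  have hsub : {ω | EveryPathHasBlockVertex r r d ε ω.1 ω.2 β}ᶜ ⊆
      {ω : SimpleGraph (Fin n) × (Sym2 (Fin n) → ℝ) | ∃ (v : Fin n) (l : List (Fin n × Bool)),
        r ≤ l.length ∧ (v :: l.map Prod.fst).Nodup ∧
        (∀ e ∈ caterpillarEdges v v l, e ∈ ω.1.edgeSet) ∧
        ε / 4 / 2 * (l.length + 1 : ℝ) ≤ ((v :: l.map Prod.fst).map (f ω.1 ω.2)).sum} := by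
    rintro ⟨G, J⟩ hω
    exact exists_heavy_caterpillar (f G J) (fun u => by simp only [f]; positivity)
      (by positivity) (fun u => (vertexWeight_nonneg_and_le_exp hε hε1 hd1 G J u).1)
      (fun u => (vertexWeight_nonneg_and_le_exp hε hε1 hd1 G J u).2) hω
  have hcompl : (graphCouplingLaw n p).real {ω | EveryPathHasBlockVertex r r d ε ω.1 ω.2 β}ᶜ ≤
      n * Real.exp (-(κ / 4 * r)) :=
    ENNReal.toReal_le_of_le_ofReal (by positivity) ((measure_mono hsub).trans hbad)
  have hexp : n * Real.exp (-(κ / 4 * r)) ≤ (n : ℝ) ^ (-(d ^ (1 / 8 : ℝ))) := by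
    rw [Real.rpow_def_of_pos hn0]
    nth_rewrite 1 [← Real.exp_log hn0]
    rw [← Real.exp_add]
    refine Real.exp_le_exp.2 ?_
    -- The extra log n offsets the prefactor `n`.
    have h1 : (1 + d ^ (1 / 8 : ℝ)) * Real.log n ≤ κ / 4 * r := by
      have h2 : Real.log n = Real.sqrt d * r := by rw [hℓ]; field_simp
      rw [h2]
      nlinarith
    nlinarith
  have huniv := measureReal_union_le (μ := graphCouplingLaw n p)
    {ω | EveryPathHasBlockVertex r r d ε ω.1 ω.2 β}
    {ω | EveryPathHasBlockVertex r r d ε ω.1 ω.2 β}ᶜ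
  rw [Set.union_compl_self, probReal_univ] at huniv
  linarith
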